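/- Let $X$ be a real Banach space with dual $X^*$ that is uniformly smooth, i.e. the limit $\lim_{t\to 0}\frac{\|x+ty\|-\|x\|}{t}$ exists uniformly for $x,y$ in the unit sphere of $X$. Let $J(x)=\{x^*\in X^* : \langle x,x^*\rangle=\|x\|^2=\|x^*\|^2\}$ be the normalized duality mapping, which is single-valued in such a space. Let $C\subset X$ be a nonempty closed convex set, $T:C\to C$ a nonexpansive mapping (i.e. $\|Tx-Ty\|\le\|x-y\|$ for all $x,y\in C$) with fixed point set $F=\{x\in C: Tx=x\}\neq\emptyset$, and $\Phi:C\to C$ a $\rho$-contraction, i.e. $\|\Phi(x)-\Phi(y)\|\le\rho\|x-y\|$ for all $x,y\in C$, where $\rho\in[0,1)$. Let $(\alpha_n)_{n\ge 0}$ be a sequence in $(0,1)$ such that (H1) $\lim_{n\to\infty}\alpha_n=0$; (H2) $\sum_{n=0}^\infty\alpha_n=\infty$; (H3) $\sum_{n=0}^\infty|\alpha_{n+1}-\alpha_n|<\infty$ or $\lim_{n\to\infty}\frac{\alpha_n}{\alpha_{n+1}}=1$. Then there is exactly one $q\in F$ satisfying the variational inequality $$\langle(\Phi-I)q,J(x-q)\rangle\le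 0\qquad\text{for all } x\in F,$$ and, for any $x_0\in C$, the sequence $(x_n)$ defined by $$x_{n+1}=T(\alpha_n\Phi(x_n)+(1-\alpha_n)x_n),\qquad n\ge 0,$$ converges strongly (in norm) to this $q$. -/

import Mathlib

open Filter Topology

/-- The norm of `X` is uniformly smooth: the limit of `(‖x + t y‖ - ‖x‖) / t` as `t → 0`, `t ≠ 0`,
exists and is attained uniformly for `x, y` in the unit sphere. -/
def UniformlySmooth (X : Type*) [NormedAddCommGroup X] [NormedSpace ℝ X] : Prop :=
  ∃ G : X × X → ℝ,
    TendstoUniformlyOn (fun (t : ℝ) (p : X × X) => (‖p.1 + t • p.2‖ - ‖p.1‖) / t) G (𝓝[≠] 0)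
      (Metric.sphere (0 : X) 1 ×ˢ Metric.sphere (0 : X) 1)

/-- The (set-valued) normalized duality mapping `J : X → 2^{X^*}`. -/
def normalizedDuality {X : Type*} [NormedAddCommGroup X] [NormedSpace ℝ X] (x : X) :
    Set (StrongDual ℝ X) :=
  {f | f x = ‖x‖ ^ 2 ∧ ‖x‖ ^ 2 = ‖f‖ ^ 2}

/-- The values of the normalized duality mapping are never empty. -/
theorem normalizedDuality_nonempty {X : Type*} [NormedAddCommGroup X] [NormedSpace ℝ X] (x : X) :
    (normalizedDuality x).Nonempty := by
  rcases eq_or_ne x 0 with rfl | hx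
  · exact ⟨0, by simp [normalizedDuality]⟩
  · obtain ⟨g, hg, hgx⟩ := exists_dual_vector ℝ x (norm_ne_zero_iff.mpr hx)
    refine ⟨‖x‖ • g, ?_, ?_⟩
    · simp [hgx, sq]
    · rw [norm_smul, hg, norm_norm, mul_one]

/-- In a uniformly smooth space the normalized duality mapping is single-valued. -/
theorem UniformlySmooth.normalizedDuality_subsingleton {X : Type*} [NormedAddCommGroup X]
    [NormedSpace ℝ X] (hX : UniformlySmooth X) (x : X) : (normalizedDuality x).Subsingleton := by
  rintro f ⟨hfx, hf⟩ g ⟨hgx, hg⟩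
  obtain ⟨G, hG⟩ := hX
  rcases eq_or_ne x 0 with rfl | hx
  · have h1 : f = 0 := by simpa using hf.symm
    have h2 : g = 0 := by simpa using hg.symm
    rw [h1, h2]
  have hr : 0 < ‖x‖ := norm_pos_iff.mpr hx
  have key : ∀ f : StrongDual ℝ X, f x = ‖x‖ ^ 2 → ‖x‖ ^ 2 = ‖f‖ ^ 2 → ∀ y : X, ‖y‖ = 1 →
      f y = ‖x‖ * G (‖x‖⁻¹ • x, y) := by
    intro f hfx hf y hy
    have hfn : ‖f‖ = ‖x‖ := by
      have := (sq_eq_sq₀ hr.le (norm_nonneg f)).mp hf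
      exact this.symm
    have hu : ‖‖x‖⁻¹ • x‖ = 1 := by
      rw [norm_smul, norm_inv, norm_norm, inv_mul_cancel₀ hr.ne']
    have hfu : f (‖x‖⁻¹ • x) = ‖x‖ := by
      rw [map_smul, hfx, smul_eq_mul]; field_simp
    set u := ‖x‖⁻¹ • x with hu_def
    have hlim : Tendsto (fun t : ℝ => (‖u + t • y‖ - ‖u‖) / t) (𝓝[≠] 0) (𝓝 (G (u, y))) :=
      hG.tendsto_at (x := (u, y)) (by simp [hu, hy])
    have hb : ∀ t : ℝ, t * f y ≤ ‖x‖ * (‖u + t • y‖ - ‖u‖) := by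
      intro t
      have h1 : f (u + t • y) ≤ ‖x‖ * ‖u + t • y‖ :=
        hfn ▸ (le_abs_self _).trans (f.le_opNorm _)
      rw [map_add, hfu, map_smul, smul_eq_mul] at h1
      rw [hu]; linarith
    have hR : Tendsto (fun t : ℝ => ‖x‖ * ((‖u + t • y‖ - ‖u‖) / t)) (𝓝[>] 0)
        (𝓝 (‖x‖ * G (u, y))) :=
      (hlim.mono_left (nhdsWithin_mono _ fun t (ht : 0 < t) => ht.ne')).const_mul _
    have hL : Tendsto (fun t : ℝ => ‖x‖ * ((‖u + t • y‖ - ‖u‖) / t)) (𝓝[<] 0)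
        (𝓝 (‖x‖ * G (u, y))) :=
      (hlim.mono_left (nhdsWithin_mono _ fun t (ht : t < 0) => ht.ne)).const_mul _
    apply le_antisymm
    · refine ge_of_tendsto hR ?_
      filter_upwards [self_mem_nhdsWithin] with t (ht : 0 < t)
      rw [← mul_div_assoc, le_div_iff₀ ht]
      linarith [hb t]
    · refine le_of_tendsto hL ?_
      filter_upwards [self_mem_nhdsWithin] with t (ht : t < 0)
      rw [← mul_div_assoc, div_le_iff_of_neg ht]
      linarith [hb t]
  ext y
  rcases eq_or_ne y 0 with rfl | hy
  · simp
  have hy' : ‖y‖ ≠ 0 := norm_ne_zero_iff.mpr hy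
  have hy1 : ‖‖y‖⁻¹ • y‖ = 1 := by
    rw [norm_smul, norm_inv, norm_norm, inv_mul_cancel₀ hy']
  have h := (key f hfx hf _ hy1).trans (key g hgx hg _ hy1).symm
  rw [map_smul, map_smul] at h
  exact smul_right_injective ℝ (inv_ne_zero hy') h

/-- The fixed point set `F = {x ∈ C : T x = x}`. -/
def fixSet {X : Type*} (C : Set X) (T : X → X) : Set X :=
  {x | x ∈ C ∧ T x = x}

/-- `q ∈ F` and `⟨(Φ - I) q, J (x - q)⟩ ≤ 0` for all `x ∈ F`. By the two facts above, `J (x - q)` is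
always nonempty, and it has exactly one element when `X` is uniformly smooth. -/
def IsVISolution {X : Type*} [NormedAddCommGroup X] [NormedSpace ℝ X] (C : Set X) (T Φ : X → X)
    (q : X) : Prop :=
  q ∈ fixSet C T ∧ ∀ x ∈ fixSet C T, ∀ j ∈ normalizedDuality (x - q), j (Φ q - q) ≤ 0

/-! The point `q` is found on the implicit path `z = t Φ z + (1 - t) T z`, whose points exist by
Banach's principle. The path is bounded, so `z - T z → 0` as `t → 0`, and a fixed point `q` of `T`
can be found among the minimizers over `C` of `lim ‖z - x‖` along an ultrafilter. Moving `q` towards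
`Φ q` gives `lim J(z - q)(Φ q - q) ≤ 0` along it, while the path equation gives `(1 - ρ) ‖z - q‖² ≤
J(z - q)(Φ q - q)`; so path points come arbitrarily close to `q`. Only this accumulation is used
afterwards, not convergence of the whole path.

Testing the path equation at approximate fixed points `y n` and replacing `z` by `q` gives `limsup
J(y n - q)(Φ q - q) ≤ 0`. For a constant sequence in `F` this is the variational inequality. For the
averages `y n` with `x (n + 1) = T (y n)`, where (H1)-(H3) yield `T (y n) - y n → 0`, it controls
the error in a recursion for `‖x n - q‖²`, which (H2) drives to zero. Uniqueness is the strict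
contractivity of `Φ`.

All the geometry comes from `exists_norm_sub_le_of_almost_norming`. It yields reflexivity
(minimizers exist), normal structure (Kirk's theorem finds a fixed point among them) and uniform
continuity of `J` on bounded sets (base points of `J` may be moved). -/

/-! ### Smoothness and almost norming functionals -/

/-- Adding the difference quotients at `t` and `-t` cancels the derivative `G (x, y)`; uniformity
lets one `t` serve all pairs. -/
theorem UniformlySmooth.exists_norm_add_norm_sub_le {X : Type*} [NormedAddCommGroup X]
    [NormedSpace ℝ X] (hX : UniformlySmooth X) {η : ℝ} (hη : 0 < η) :
    ∃ t > 0, ∀ x y : X, ‖x‖ = 1 → ‖y‖ = 1 → ‖x + t • y‖ + ‖x - t • y‖ ≤ 2 + η * t := by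
  obtain ⟨G, hG⟩ := hX
  have h := Metric.tendstoUniformlyOn_iff.mp hG (η / 2) (by positivity)
  rw [eventually_nhdsWithin_iff, Metric.eventually_nhds_iff] at h
  obtain ⟨δ, hδ, h⟩ := h
  have ht : 0 < δ / 2 := by positivity
  refine ⟨δ / 2, ht, fun x y hx hy => ?_⟩
  have hm : (x, y) ∈ Metric.sphere (0 : X) 1 ×ˢ Metric.sphere (0 : X) 1 := by simp [hx, hy]
  have h1 := h (y := δ / 2) (by simp [abs_of_pos hδ, hδ]) (by simp [hδ.ne']) _ hm
  have h2 := h (y := -(δ / 2)) (by simp [abs_of_pos hδ, hδ]) (by simp [hδ.ne']) _ hm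
  rw [Real.dist_eq, abs_lt] at h1 h2
  simp only [hx, neg_smul, ← sub_eq_add_neg, div_neg] at h1 h2
  generalize δ / 2 = t at *
  have h3 : (‖x + t • y‖ - 1) / t < G (x, y) + η / 2 := by linarith
  have h4 : (‖x - t • y‖ - 1) / t < - G (x, y) + η / 2 := by linarith
  rw [div_lt_iff₀ ht] at h3 h4
  linarith

/-- In a uniformly smooth space, two functionals in the dual unit ball that almost attain the value
one at a common point of the unit ball are close. -/
theorem UniformlySmooth.exists_norm_sub_le_of_almost_norming {X : Type*} [NormedAddCommGroup X]
    [NormedSpace ℝ X] (hX : UniformlySmooth X) {ε : ℝ} (hε : 0 < ε) :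
    ∃ δ > 0, ∀ f g : StrongDual ℝ X, ‖f‖ ≤ 1 → ‖g‖ ≤ 1 → ∀ u : X, ‖u‖ ≤ 1 →
      1 - δ ≤ f u → 1 - δ ≤ g u → ‖f - g‖ ≤ ε := by
  obtain ⟨t, ht, h⟩ := hX.exists_norm_add_norm_sub_le (half_pos hε)
  -- The bound `1 / 2` forces `u ≠ 0`, so that `u` can be normalized; `ε * t / 4` absorbs the loss
  -- `2 * δ` in `f v + g v`.
  refine ⟨min (1 / 2) (ε * t / 4), by positivity, fun f g hf hg u hu hfu hgu => ?_⟩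
  have hm1 := min_le_left (1 / 2) (ε * t / 4)
  have hm2 := min_le_right (1 / 2) (ε * t / 4)
  set δ := min (1 / 2) (ε * t / 4)
  have hbd : ∀ f : StrongDual ℝ X, ‖f‖ ≤ 1 → ∀ z, f z ≤ ‖z‖ := fun f hf z =>
    (le_abs_self _).trans ((f.le_opNorm z).trans (mul_le_of_le_one_left (norm_nonneg z) hf))
  have hu0 : 0 < ‖u‖ := by linarith [hbd f hf u]
  have hscale : ∀ f : StrongDual ℝ X, 1 - δ ≤ f u → 1 - δ ≤ f (‖u‖⁻¹ • u) := by
    intro f hfu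
    rw [map_smul, smul_eq_mul]
    have : 1 ≤ ‖u‖⁻¹ := (one_le_inv₀ hu0).mpr hu
    nlinarith
  have hv : ‖‖u‖⁻¹ • u‖ = 1 := by rw [norm_smul, norm_inv, norm_norm, inv_mul_cancel₀ hu0.ne']
  have hfv := hscale f hfu
  have hgv := hscale g hgu
  generalize ‖u‖⁻¹ • u = v at *
  -- Evaluate `f` at `v + t • y` and `g` at `v - t • y`, and add.
  have hone : ∀ y : X, ‖y‖ = 1 → (f - g) y ≤ ε := by
    intro y hy
    have h1 := hbd f hf (v + t • y)
    have h2 := hbd g hg (v - t • y)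
    have h3 := h v y hv hy
    simp only [map_add, map_sub, map_smul, smul_eq_mul] at h1 h2
    have : t * (f y - g y) ≤ t * ε := by linarith
    exact le_of_mul_le_mul_left this ht
  refine ContinuousLinearMap.opNorm_le_of_unit_norm hε.le fun y hy => ?_
  rw [Real.norm_eq_abs, abs_le]
  have := hone (-y) (by rwa [norm_neg])
  rw [map_neg] at this
  exact ⟨by linarith, hone y hy⟩

/-! ### Reflexivity -/

theorem StrongDual.exists_lt_apply_of_lt_norm {E : Type*} [NormedAddCommGroup E] [NormedSpace ℝ E]
    (f : StrongDual ℝ E) {r : ℝ} (hr : r < ‖f‖) : ∃ x, ‖x‖ ≤ 1 ∧ r < f x := by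
  obtain ⟨x, hx, h⟩ := f.exists_lt_apply_of_lt_opNorm hr
  rw [Real.norm_eq_abs, lt_abs] at h
  rcases h with h | h
  · exact ⟨x, hx.le, h⟩
  · exact ⟨-x, by rw [norm_neg]; exact hx.le, by rwa [map_neg]⟩

/-- A functional on `E` that stays at distance at least `r` from the line through `φ`, where
`φ e ≠ 0`, has norm at least `r` on the kernel of `φ`. -/
theorem StrongDual.exists_lt_apply_of_forall_le_norm_sub_smul {E : Type*} [NormedAddCommGroup E]
    [NormedSpace ℝ E] (ψ φ : StrongDual ℝ E) {e : E} (he : φ e ≠ 0) {r s : ℝ} (hsr : s < r)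
    (h : ∀ c : ℝ, r ≤ ‖ψ - c • φ‖) : ∃ x, ‖x‖ ≤ 1 ∧ φ x = 0 ∧ s < ψ x := by
  obtain ⟨g, hg, hgn⟩ := exists_extension_norm_eq (LinearMap.ker (φ : E →ₗ[ℝ] ℝ))
    (ψ.comp (LinearMap.ker (φ : E →ₗ[ℝ] ℝ)).subtypeL)
  -- `ψ - g` vanishes on the kernel of `φ`, hence is a multiple of `φ`.
  have hgc : g = ψ - ((ψ e - g e) / φ e) • φ := by
    ext x
    have hx : x - (φ x / φ e) • e ∈ LinearMap.ker (φ : E →ₗ[ℝ] ℝ) := by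
      simp [he]
    have := hg ⟨_, hx⟩
    simp only [ContinuousLinearMap.comp_apply, Submodule.subtypeL_apply, map_sub, map_smul,
      smul_eq_mul] at this
    simp only [sub_apply, smul_apply, smul_eq_mul]
    field_simp at this ⊢
    linarith
  have hn := h ((ψ e - g e) / φ e)
  rw [← hgc, hgn] at hn
  obtain ⟨x, hx, hxs⟩ := StrongDual.exists_lt_apply_of_lt_norm _ (hsr.trans_le hn)
  exact ⟨x, hx, by simp, hxs⟩

theorem riesz_lemma_norm_eq_one {E : Type*} [NormedAddCommGroup E] [NormedSpace ℝ E]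
    {F : Submodule ℝ E} (hFc : IsClosed (F : Set E)) (hF : ∃ x, x ∉ F) {r : ℝ} (hr : r < 1) :
    ∃ ψ : E, ‖ψ‖ = 1 ∧ ∀ y ∈ F, r ≤ ‖ψ - y‖ := by
  obtain ⟨φ, hφF, hφ⟩ := riesz_lemma hFc hF hr
  have hφ0 : 0 < ‖φ‖ := by
    refine norm_pos_iff.mpr ?_
    rintro rfl
    exact hφF F.zero_mem
  refine ⟨‖φ‖⁻¹ • φ, by rw [norm_smul, norm_inv, norm_norm, inv_mul_cancel₀ hφ0.ne'],
    fun y hy => ?_⟩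
  have h1 := hφ (‖φ‖ • y) (F.smul_mem _ hy)
  have h2 : φ - ‖φ‖ • y = ‖φ‖ • (‖φ‖⁻¹ • φ - y) := by
    rw [smul_sub, smul_smul, mul_inv_cancel₀ hφ0.ne', one_smul]
  rw [h2, norm_smul, norm_norm, mul_comm] at h1
  exact le_of_mul_le_mul_left h1 hφ0

/-- A uniformly smooth Banach space is reflexive. -/
theorem UniformlySmooth.inclusionInDoubleDual_surjective {X : Type*} [NormedAddCommGroup X]
    [NormedSpace ℝ X] [CompleteSpace X] (hX : UniformlySmooth X) :
    Function.Surjective (NormedSpace.inclusionInDoubleDual ℝ X) := by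
  by_contra hsurj
  obtain ⟨δ, hδ, hclose⟩ := hX.exists_norm_sub_le_of_almost_norming (ε := 1 / 2) (by norm_num)
  set J := NormedSpace.inclusionInDoubleDualLi ℝ (E := X) with hJ
  have hJa : ∀ x f, J x f = f x := fun _ _ => rfl
  set S : Submodule ℝ (StrongDual ℝ (StrongDual ℝ X)) := LinearMap.range J.toLinearMap with hS
  have hScl : IsClosed (S : Set (StrongDual ℝ (StrongDual ℝ X))) := by
    have : (S : Set (StrongDual ℝ (StrongDual ℝ X))) = Set.range J := by ext; simp [hS]
    rw [this]
    exact J.isometry.isUniformInducing.isComplete_range.isClosed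
  have hSne : ∃ φ, φ ∉ S := by
    by_contra! hall
    refine hsurj fun φ => ?_
    obtain ⟨x, hx⟩ := hall φ
    exact ⟨x, hx⟩
  set c := min δ (1 / 4) with hc
  have hc0 : 0 < c := by positivity
  have hcδ : c ≤ δ := min_le_left _ _
  have hc4 : c ≤ 1 / 4 := min_le_right _ _
  -- The plan: find `f₁`, `f₂` in the dual ball, both almost norming `ψ`, with `f₁ x₁ > 3 / 4` and
  -- `f₂ x₁ = 0`. Then `f₁ + f₂` has norm near 2, so both almost norm a common `u` in `X` and must
  -- be close, which fails at `x₁`.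
  obtain ⟨ψ, hψ1, hψS⟩ := riesz_lemma_norm_eq_one (E := StrongDual ℝ (StrongDual ℝ X)) (F := S)
    hScl hSne (r := 1 - c / 4) (by linarith)
  have hψle : ∀ f, ψ f ≤ ‖f‖ := fun f => by
    simpa [hψ1] using (le_abs_self _).trans (ψ.le_opNorm f)
  obtain ⟨f₁, hf₁, hψ₁⟩ := StrongDual.exists_lt_apply_of_lt_norm ψ (r := 1 - c / 3)
    (by rw [hψ1]; linarith)
  obtain ⟨x₁, hx₁, hfx₁⟩ := StrongDual.exists_lt_apply_of_lt_norm f₁ (r := 3 / 4)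
    (by linarith [hψle f₁])
  obtain ⟨f₂, hf₂, hfx₂, hψ₂⟩ := StrongDual.exists_lt_apply_of_forall_le_norm_sub_smul ψ (J x₁)
    (e := f₁) (by rw [hJa]; linarith) (s := 1 - c / 3) (r := 1 - c / 4) (by linarith)
    (fun a => hψS _ (S.smul_mem _ ⟨x₁, rfl⟩))
  rw [hJa] at hfx₂
  obtain ⟨u, hu, hfu⟩ := StrongDual.exists_lt_apply_of_lt_norm (f₁ + f₂) (r := 2 - 2 * c / 3)
    (by have := hψle (f₁ + f₂); rw [map_add] at this; linarith)
  have hbd : ∀ f : StrongDual ℝ X, ‖f‖ ≤ 1 → ∀ z, ‖z‖ ≤ 1 → f z ≤ 1 := fun f hf z hz =>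
    (le_abs_self _).trans (f.le_of_opNorm_le_of_le hf hz |>.trans (by norm_num))
  rw [add_apply] at hfu
  have h := hclose f₁ f₂ hf₁ hf₂ u hu (by linarith [hbd f₂ hf₂ u hu]) (by linarith [hbd f₁ hf₁ u hu])
  have h' := (le_abs_self _).trans ((f₁ - f₂).le_of_opNorm_le_of_le h hx₁)
  rw [sub_apply, hfx₂] at h'
  linarith

/-! ### Weak compactness -/

/-- In a uniformly smooth Banach space, bounded families have weak limits along ultrafilters. -/
theorem UniformlySmooth.exists_weak_limit {X : Type*} [NormedAddCommGroup X]
    [NormedSpace ℝ X] [CompleteSpace X] (hX : UniformlySmooth X) {ι : Type*} (U : Ultrafilter ι)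
    {x : ι → X} {R : ℝ} (hx : ∀ᶠ i in U, ‖x i‖ ≤ R) :
    ∃ a, ∀ f : StrongDual ℝ X, Tendsto (fun i => f (x i)) U (𝓝 (f a)) := by
  let y : ι → WeakDual ℝ (StrongDual ℝ X) := fun i =>
    StrongDual.toWeakDual (NormedSpace.inclusionInDoubleDual ℝ X (x i))
  have hy : ∀ᶠ i in U, y i ∈ WeakDual.toStrongDual ⁻¹'
      Metric.closedBall (0 : StrongDual ℝ (StrongDual ℝ X)) R := by
    filter_upwards [hx] with i hi
    refine (mem_closedBall_zero_iff (E := StrongDual ℝ (StrongDual ℝ X))).mpr ?_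
    exact (NormedSpace.double_dual_bound ℝ X (x i)).trans hi
  -- Banach-Alaoglu in the bidual gives a limit, which reflexivity places in `X`.
  obtain ⟨φ, -, hφ⟩ := (WeakDual.isCompact_closedBall (0 : StrongDual ℝ (StrongDual ℝ X))
    R).ultrafilter_le_nhds (U.map y) (by
      rw [le_principal_iff]; exact Filter.mem_map.mpr hy)
  obtain ⟨a, ha⟩ := hX.inclusionInDoubleDual_surjective (WeakDual.toStrongDual φ)
  refine ⟨a, fun f => ?_⟩
  have h := ((WeakDual.eval_continuous f).tendsto φ).comp
    (show Tendsto y U (𝓝 φ) from hφ)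
  have e : φ f = f a := by
    rw [← NormedSpace.dual_def ℝ X, ha]; rfl
  rw [e] at h
  exact h

theorem mem_of_weak_limit {X : Type*} [NormedAddCommGroup X] [NormedSpace ℝ X] {ι : Type*}
    {U : Filter ι} [U.NeBot] {x : ι → X} {a : X}
    (ha : ∀ f : StrongDual ℝ X, Tendsto (fun i => f (x i)) U (𝓝 (f a))) {C : Set X}
    (hC : Convex ℝ C) (hCcl : IsClosed C) (hxC : ∀ᶠ i in U, x i ∈ C) : a ∈ C := by
  by_contra h
  obtain ⟨f, u, hu, hua⟩ := geometric_hahn_banach_closed_point hC hCcl h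
  exact absurd (le_of_tendsto (ha f) (hxC.mono fun i hi => (hu _ hi).le)) (not_le.mpr hua)

/-- An ultrafilter containing every `A i` has a weak limit, and closed convex sets are weakly
closed. -/
theorem UniformlySmooth.nonempty_iInter_of_directed {X : Type*} [NormedAddCommGroup X]
    [NormedSpace ℝ X] [CompleteSpace X] (hX : UniformlySmooth X) {ι : Type*} [Nonempty ι]
    {A : ι → Set X} (hA : Directed (· ⊇ ·) A) (hne : ∀ i, (A i).Nonempty)
    (hcl : ∀ i, IsClosed (A i)) (hconv : ∀ i, Convex ℝ (A i))
    {R : ℝ} {i₀ : ι} (hR : ∀ x ∈ A i₀, ‖x‖ ≤ R) : (⋂ i, A i).Nonempty := by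
  have hdir : Directed (· ≥ ·) fun i => 𝓟 (A i) := fun i j => by
    obtain ⟨k, hik, hjk⟩ := hA i j
    exact ⟨k, principal_mono.mpr hik, principal_mono.mpr hjk⟩
  have : (⨅ i, 𝓟 (A i)).NeBot :=
    iInf_neBot_of_directed' hdir fun i => principal_neBot_iff.mpr (hne i)
  let U := Ultrafilter.of (⨅ i, 𝓟 (A i))
  have hU : ∀ i, ∀ᶠ x in U, x ∈ A i := fun i =>
    (Ultrafilter.of_le (⨅ i, 𝓟 (A i))) ((iInf_le (fun i => 𝓟 (A i)) i) (mem_principal_self _))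
  obtain ⟨a, ha⟩ := hX.exists_weak_limit U (x := id) ((hU i₀).mono hR)
  exact ⟨a, Set.mem_iInter.mpr fun i => mem_of_weak_limit ha (hconv i) (hcl i) (hU i)⟩

/-! ### Normal structure and Kirk's fixed point theorem -/

/-- If a convex set of diameter at most `d` contains points at distance almost `d` from each of its
points, it contains points at distance almost `d` from all points of any given finite subset. -/
theorem exists_far_from_finset {X : Type*} [NormedAddCommGroup X] [NormedSpace ℝ X] {M : Set X}
    (hM : Convex ℝ M) (hne : M.Nonempty) {d e : ℝ} (he : 0 < e)
    (hd : ∀ x ∈ M, ∀ y ∈ M, ‖x - y‖ ≤ d) (H : ∀ x ∈ M, ∀ r < d, ∃ y ∈ M, r < ‖x - y‖)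
    (S : Finset M) : ∃ y ∈ M, ∀ x ∈ S, d - e ≤ ‖(x : X) - y‖ := by
  rcases S.eq_empty_or_nonempty with rfl | hS
  · obtain ⟨y, hy⟩ := hne
    exact ⟨y, hy, by simp⟩
  have hN : (0 : ℝ) < S.card := by exact_mod_cast hS.card_pos
  set c : X := ∑ x ∈ S, (S.card : ℝ)⁻¹ • (x : X) with hc
  have hcM : c ∈ M := hM.sum_mem (fun _ _ => by positivity) (by simp [hN.ne']) fun x _ => x.2
  -- A point far from the barycentre is far from every point of `S`: the distances average at least
  -- `d - e / S.card`, and none exceeds `d`.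
  obtain ⟨y, hyM, hy⟩ := H c hcM (d - e / S.card) (by linarith [div_pos he hN])
  refine ⟨y, hyM, fun x hx => ?_⟩
  have h1 : S.card • (c - y) = ∑ x ∈ S, ((x : X) - y) := by
    rw [Finset.sum_sub_distrib, Finset.sum_const, smul_sub, hc, ← Finset.smul_sum,
      ← Nat.cast_smul_eq_nsmul ℝ, smul_smul, mul_inv_cancel₀ hN.ne', one_smul]
  have h2 : S.card * ‖c - y‖ ≤ ∑ x ∈ S, ‖(x : X) - y‖ := by
    have := norm_sum_le S fun x => (x : X) - y
    rwa [← h1, ← Nat.cast_smul_eq_nsmul ℝ, norm_smul, Real.norm_natCast] at this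
  have h3 := Finset.single_le_sum (f := fun x : M => d - ‖(x : X) - y‖)
    (fun x _ => sub_nonneg.mpr (hd x x.2 y hyM)) hx
  simp only [Finset.sum_sub_distrib, Finset.sum_const, nsmul_eq_mul] at h3
  have h4 : S.card * (d - e / S.card) < S.card * ‖c - y‖ := mul_lt_mul_of_pos_left hy hN
  have h5 : S.card * (d - e / S.card) = S.card * d - e := by field_simp
  linarith

/-- Uniformly smooth Banach spaces have normal structure. -/
theorem UniformlySmooth.exists_nondiametral {X : Type*} [NormedAddCommGroup X]
    [NormedSpace ℝ X] [CompleteSpace X] (hX : UniformlySmooth X) {M : Set X} (hM : Convex ℝ M)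
    (hMcl : IsClosed M) (hne : M.Nonempty) {d : ℝ} (hd0 : 0 < d)
    (hd : ∀ x ∈ M, ∀ y ∈ M, ‖x - y‖ ≤ d) :
    ∃ x ∈ M, ∃ r < d, ∀ y ∈ M, ‖x - y‖ ≤ r := by
  by_contra! H
  obtain ⟨δ, hδ, hclose⟩ := hX.exists_norm_sub_le_of_almost_norming (ε := 1 / 2) (by norm_num)
  set m := min δ (1 / 4) with hm
  have hm0 : 0 < m := by positivity
  have hmδ : m ≤ δ := min_le_left _ _
  have hm4 : m ≤ 1 / 4 := min_le_right _ _
  set e := d * m / 2 with he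
  have he0 : 0 < e := by positivity
  have hed : e ≤ d / 8 := by rw [he]; nlinarith
  have hbd : ∀ f : StrongDual ℝ X, ‖f‖ ≤ 1 → ∀ z, ‖z‖ ≤ d → f z ≤ d := fun f hf z hz =>
    (le_abs_self _).trans (f.le_of_opNorm_le_of_le hf hz |>.trans (by rw [one_mul]))
  choose Y hYM hY using exists_far_from_finset hM hne he0 hd H
  let U := Ultrafilter.of (atTop : Filter (Finset M))
  have hU : (U : Filter (Finset M)) ≤ atTop := Ultrafilter.of_le _
  obtain ⟨m₀, hm₀⟩ := hne
  obtain ⟨b, hb⟩ := hX.exists_weak_limit U (x := Y) (R := d + ‖m₀‖) (Eventually.of_forall fun S => by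
    have := norm_add_le (Y S - m₀) m₀
    rw [sub_add_cancel] at this
    linarith [hd _ (hYM S) _ hm₀])
  have hbM : b ∈ M := mem_of_weak_limit hb hM hMcl (Eventually.of_forall hYM)
  -- For suitable `y = Y S`, `-f` almost attains `d` at `a - y` because `f y` is close to `f b`.
  -- Since `y` is also far from the midpoint of `a` and `b`, `g` almost attains `d` at both `a - y`
  -- and `b - y`. So `-f` and `g` are close, yet on `a - b` the first is almost `d` and the second
  -- at most `2 * e`.
  obtain ⟨a, haM, hab⟩ := H b hbM (d - e) (by linarith)
  obtain ⟨f, hf, hfa⟩ := exists_dual_vector'' ℝ (b - a)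
  have hmid : (1 / 2 : ℝ) • a + (1 / 2 : ℝ) • b ∈ M :=
    hM haM hbM (by norm_num) (by norm_num) (by norm_num)
  obtain ⟨S, hS1, hS2⟩ := (((hb f).eventually (eventually_gt_nhds (show f b - e < f b by linarith))).and
    (hU (eventually_ge_atTop {⟨_, hmid⟩}))).exists
  have hfar := hY S _ (hS2 (Finset.mem_singleton_self _))
  have hya := hd _ haM _ (hYM S)
  have hyb := hd _ hbM _ (hYM S)
  generalize Y S = y at *
  obtain ⟨g, hg, hgy⟩ := exists_dual_vector'' ℝ ((1 / 2 : ℝ) • a + (1 / 2 : ℝ) • b - y)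
  have hga := hbd g hg _ hya
  have hgb := hbd g hg _ hyb
  simp only [RCLike.ofReal_real_eq_id, id_eq] at hfa hgy
  rw [← hfa] at hab
  rw [← hgy] at hfar
  simp only [map_sub, map_add, map_smul, smul_eq_mul] at hab hfar hga hgb
  have key := hclose (-f) g (by rwa [norm_neg]) hg (d⁻¹ • (a - y))
    (by rw [norm_smul, norm_inv, Real.norm_of_nonneg hd0.le, inv_mul_le_iff₀ hd0]; linarith)
  have hscale : ∀ s, d - 2 * e ≤ s → 1 - δ ≤ d⁻¹ * s := fun s hs => by
    rw [inv_mul_eq_div, le_div_iff₀ hd0]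
    nlinarith
  have h1 := key (by
      rw [map_smul, smul_eq_mul]
      refine hscale _ ?_
      simp only [map_sub, neg_apply]
      linarith) (by
      rw [map_smul, smul_eq_mul]
      refine hscale _ ?_
      rw [map_sub]
      linarith)
  have h2 := (le_abs_self _).trans ((-f - g).le_of_opNorm_le_of_le h1 (hd _ haM _ hbM))
  simp only [sub_apply, neg_apply, map_sub] at h2
  linarith

/-- Nonexpansive self-maps of bounded closed convex sets in uniformly smooth Banach spaces have
fixed points. -/
theorem UniformlySmooth.exists_fixed_point {X : Type*} [NormedAddCommGroup X]
    [NormedSpace ℝ X] [CompleteSpace X] (hX : UniformlySmooth X) {K : Set X} (hK : Convex ℝ K)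
    (hKcl : IsClosed K) (hne : K.Nonempty) {R : ℝ} (hR : ∀ x ∈ K, ‖x‖ ≤ R) {T : X → X}
    (hTK : Set.MapsTo T K K) (hT : ∀ x ∈ K, ∀ y ∈ K, ‖T x - T y‖ ≤ ‖x - y‖) :
    ∃ x ∈ K, T x = x := by
  obtain ⟨M, hMK, hMmin⟩ := zorn_superset_nonempty
    {A : Set X | A ⊆ K ∧ A.Nonempty ∧ IsClosed A ∧ Convex ℝ A ∧ Set.MapsTo T A A} (by
      intro c hc hchain hcne
      have : Nonempty c := hcne.to_subtype
      obtain ⟨A₀, hA₀⟩ := hcne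
      refine ⟨⋂₀ c, ⟨?_, ?_, ?_, ?_, ?_⟩, fun s hs => Set.sInter_subset_of_mem hs⟩
      · exact (Set.sInter_subset_of_mem hA₀).trans (hc hA₀).1
      · rw [Set.sInter_eq_iInter]
        refine hX.nonempty_iInter_of_directed ?_ (fun i => (hc i.2).2.1) (fun i => (hc i.2).2.2.1)
          (fun i => (hc i.2).2.2.2.1) (R := R) (i₀ := ⟨A₀, hA₀⟩) fun x hx => hR x ((hc hA₀).1 hx)
        intro i j
        rcases hchain.total i.2 j.2 with h | h
        · exact ⟨i, subset_rfl, h⟩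
        · exact ⟨j, h, subset_rfl⟩
      · exact isClosed_sInter fun s hs => (hc hs).2.2.1
      · exact convex_sInter fun s hs => (hc hs).2.2.2.1
      · exact fun x hx s hs => (hc hs).2.2.2.2 (hx s hs)) K ⟨subset_rfl, hne, hKcl, hK, hTK⟩
  obtain ⟨-, hMne, hMcl, hMconv, hTM⟩ := hMmin.prop
  have hmin : ∀ A ⊆ M, A.Nonempty → IsClosed A → Convex ℝ A → Set.MapsTo T A A → M ⊆ A :=
    fun A hA h1 h2 h3 h4 => hMmin.le_of_le ⟨hA.trans hMK, h1, h2, h3, h4⟩ hA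
  have hbdd : Bornology.IsBounded M :=
    isBounded_iff_forall_norm_le.mpr ⟨R, fun x hx => hR x (hMK hx)⟩
  have hdiam : ∀ x ∈ M, ∀ y ∈ M, ‖x - y‖ ≤ Metric.diam M := fun x hx y hy => by
    rw [← dist_eq_norm]; exact Metric.dist_le_diam_of_mem hbdd hx hy
  obtain ⟨x₀, hx₀⟩ := hMne
  rcases (Metric.diam_nonneg (s := M)).eq_or_lt with h0 | hpos
  · refine ⟨x₀, hMK hx₀, ?_⟩
    have := hdiam _ (hTM hx₀) _ hx₀
    rw [← h0] at this
    exact sub_eq_zero.mp (norm_le_zero_iff.mp this)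
  exfalso
  obtain ⟨x, hx, r, hr, hxr⟩ := hX.exists_nondiametral hMconv hMcl ⟨x₀, hx₀⟩ hpos hdiam
  have hset : ∀ A B : Set X, A ∩ {x | ∀ y ∈ B, ‖x - y‖ ≤ r} = A ∩ ⋂ y ∈ B, Metric.closedBall y r := by
    intro A B
    ext x
    simp [dist_eq_norm]
  -- This set of centres is invariant: for a centre `x`, `M ∩ closedBall (T x) r` is itself
  -- invariant, so it is all of `M` by minimality. Hence every point of `M` is a centre and the
  -- diameter drops to `r`.
  have hsub := hmin (M ∩ {x | ∀ y ∈ M, ‖x - y‖ ≤ r}) Set.inter_subset_left ⟨x, hx, hxr⟩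
    (by
      rw [hset]
      exact hMcl.inter (isClosed_biInter fun _ _ => Metric.isClosed_closedBall))
    (by
      rw [hset]
      exact hMconv.inter (convex_iInter₂ fun _ _ => convex_closedBall _ _))
    (by
      rintro x ⟨hx, hxr⟩
      refine ⟨hTM hx, fun y hy => ?_⟩
      have := hmin (M ∩ Metric.closedBall (T x) r) Set.inter_subset_left
        ⟨T x, hTM hx, by
          have := (norm_nonneg _).trans (hxr x hx)
          simpa using this⟩
        (hMcl.inter Metric.isClosed_closedBall) (hMconv.inter (convex_closedBall _ _))
        (fun z hz => ⟨hTM hz.1, by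
          rw [Metric.mem_closedBall, dist_comm, dist_eq_norm]
          exact (hT _ (hMK hx) _ (hMK hz.1)).trans (hxr z hz.1)⟩) hy
      rw [← dist_eq_norm, dist_comm]
      exact this.2)
  have : Metric.diam M ≤ r := Metric.diam_le_of_forall_dist_le
    ((norm_nonneg _).trans (hxr x hx)) fun x hx y hy => by
      rw [dist_eq_norm]; exact (hsub hx).2 y hy
  linarith

/-! ### The duality mapping -/

/-- A selection of the normalized duality mapping. -/
noncomputable def dualityMap {X : Type*} [NormedAddCommGroup X] [NormedSpace ℝ X] (x : X) :
    StrongDual ℝ X :=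
  (normalizedDuality_nonempty x).some

section DualityMap

variable {X : Type*} [NormedAddCommGroup X] [NormedSpace ℝ X]

theorem dualityMap_mem (x : X) : dualityMap x ∈ normalizedDuality x :=
  (normalizedDuality_nonempty x).some_mem

theorem dualityMap_apply_self (x : X) : dualityMap x x = ‖x‖ ^ 2 :=
  (dualityMap_mem x).1

theorem norm_dualityMap (x : X) : ‖dualityMap x‖ = ‖x‖ :=
  ((sq_eq_sq₀ (norm_nonneg _) (norm_nonneg _)).mp (dualityMap_mem x).2).symm

theorem dualityMap_apply_le (x y : X) : dualityMap x y ≤ ‖x‖ * ‖y‖ :=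
  (le_abs_self _).trans (norm_dualityMap x ▸ (dualityMap x).le_opNorm y)

theorem UniformlySmooth.eq_dualityMap (hX : UniformlySmooth X) {x : X} {f : StrongDual ℝ X}
    (hf : f ∈ normalizedDuality x) : f = dualityMap x :=
  hX.normalizedDuality_subsingleton x hf (dualityMap_mem x)

theorem UniformlySmooth.dualityMap_neg (hX : UniformlySmooth X) (x : X) :
    dualityMap (-x) = -dualityMap x :=
  (hX.eq_dualityMap ⟨by simp [dualityMap_apply_self], by simp [norm_dualityMap]⟩).symm

theorem UniformlySmooth.dualityMap_sub_comm (hX : UniformlySmooth X) (x y v : X) :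
    dualityMap (x - y) v = -dualityMap (y - x) v := by
  rw [← neg_sub y x, hX.dualityMap_neg, neg_apply]

/-- In a uniformly smooth space the duality mapping is uniformly continuous on bounded sets. -/
theorem UniformlySmooth.dualityMap_uniformContinuous (hX : UniformlySmooth X) {R ε : ℝ}
    (hR : 0 ≤ R) (hε : 0 < ε) : ∃ δ > 0, ∀ x y : X, ‖x‖ ≤ R → ‖x - y‖ ≤ δ →
      ‖dualityMap x - dualityMap y‖ ≤ ε := by
  obtain ⟨δ₀, hδ₀, hclose⟩ := hX.exists_norm_sub_le_of_almost_norming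
    (ε := ε / (2 * (R + 1))) (by positivity)
  refine ⟨min (ε / 8) (ε * δ₀ / 8), by positivity, fun x y hx hxy => ?_⟩
  have h1 := min_le_left (ε / 8) (ε * δ₀ / 8)
  have h2 := min_le_right (ε / 8) (ε * δ₀ / 8)
  set δ := min (ε / 8) (ε * δ₀ / 8)
  have hyx : ‖y‖ ≤ ‖x‖ + δ := by
    have := norm_sub_norm_le y x
    rw [norm_sub_rev] at this
    linarith
  have hxy' : ‖x‖ ≤ ‖y‖ + δ := by linarith [norm_sub_norm_le x y]
  -- Near the origin both functionals are small; elsewhere, after normalization, both almost norm `x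
  -- / ‖x‖`.
  rcases le_or_gt ‖x‖ (ε / 4) with hsmall | hbig
  · refine (norm_sub_le _ _).trans ?_
    rw [norm_dualityMap, norm_dualityMap]
    linarith
  have hx0 : 0 < ‖x‖ := by linarith
  have hy0 : 0 < ‖y‖ := by linarith
  have hunit : ∀ z : X, 0 < ‖z‖ → ‖‖z‖⁻¹ • dualityMap z‖ ≤ 1 := fun z hz => by
    rw [norm_smul, norm_inv, norm_norm, norm_dualityMap, inv_mul_cancel₀ hz.ne']
  have hc := hclose (‖x‖⁻¹ • dualityMap x) (‖y‖⁻¹ • dualityMap y) (hunit x hx0) (hunit y hy0)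
    (‖x‖⁻¹ • x) (by rw [norm_smul, norm_inv, norm_norm, inv_mul_cancel₀ hx0.ne'])
    (by
      simp only [smul_apply, map_smul, smul_eq_mul, dualityMap_apply_self]
      have : ‖x‖⁻¹ * (‖x‖⁻¹ * ‖x‖ ^ 2) = 1 := by field_simp
      linarith)
    (by
      simp only [smul_apply, map_smul, smul_eq_mul]
      have h3 : ‖y‖ * (‖y‖ - δ) ≤ dualityMap y x := by
        have h4 := dualityMap_apply_le y (y - x)
        rw [map_sub, dualityMap_apply_self, norm_sub_rev y x] at h4
        nlinarith
      have h5 : ‖y‖⁻¹ * dualityMap y x ≥ ‖y‖ - δ := by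
        rw [ge_iff_le, inv_mul_eq_div, le_div_iff₀ hy0]
        linarith
      rw [inv_mul_eq_div, le_div_iff₀ hx0]
      nlinarith)
  have hsplit : dualityMap x - dualityMap y =
      ‖x‖ • (‖x‖⁻¹ • dualityMap x - ‖y‖⁻¹ • dualityMap y) +
        (‖x‖ - ‖y‖) • (‖y‖⁻¹ • dualityMap y) := by
    ext v
    simp only [sub_apply, add_apply, smul_apply, smul_eq_mul]
    field_simp
    ring
  have hRc : ‖x‖ * (ε / (2 * (R + 1))) ≤ ε / 2 := by
    rw [← mul_div_assoc, div_le_div_iff₀ (by positivity) (by norm_num)]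
    nlinarith
  rw [hsplit]
  refine (norm_add_le _ _).trans ?_
  rw [norm_smul, norm_smul, norm_norm, Real.norm_eq_abs]
  have h6 : |‖x‖ - ‖y‖| ≤ δ := abs_le.mpr ⟨by linarith, by linarith⟩
  have h7 := mul_le_mul h6 (hunit y hy0) (norm_nonneg _) ((abs_nonneg _).trans h6)
  have h8 := mul_le_mul_of_nonneg_left hc hx0.le
  linarith

end DualityMap

/-! ### The implicit viscosity path -/

section ViscosityPath

variable {X : Type*} [NormedAddCommGroup X] [NormedSpace ℝ X] {C : Set X} {T Φ : X → X} {ρ t : ℝ}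

theorem exists_viscosity_point [CompleteSpace X] (hCne : C.Nonempty) (hCcl : IsClosed C)
    (hCconv : Convex ℝ C) (hTC : Set.MapsTo T C C)
    (hT : ∀ x ∈ C, ∀ y ∈ C, ‖T x - T y‖ ≤ ‖x - y‖) (hΦC : Set.MapsTo Φ C C) (hρ0 : 0 ≤ ρ)
    (hρ1 : ρ < 1) (hΦ : ∀ x ∈ C, ∀ y ∈ C, ‖Φ x - Φ y‖ ≤ ρ * ‖x - y‖) (ht : t ∈ Set.Ioo (0 : ℝ) 1) :
    ∃ z ∈ C, t • Φ z + (1 - t) • T z = z := by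
  obtain ⟨ht0, ht1⟩ := ht
  have hmaps : Set.MapsTo (fun z => t • Φ z + (1 - t) • T z) C C := fun z hz =>
    hCconv (hΦC hz) (hTC hz) ht0.le (by linarith) (by ring)
  have hK0 : 0 ≤ 1 - t * (1 - ρ) := by nlinarith
  obtain ⟨x, hx⟩ := hCne
  obtain ⟨z, hz, hfix, -⟩ := ContractingWith.exists_fixedPoint' (K := (1 - t * (1 - ρ)).toNNReal)
    hCcl.isComplete hmaps ⟨by
      rw [Real.toNNReal_lt_one]
      nlinarith, LipschitzWith.of_dist_le_mul fun a b => by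
      rw [Real.coe_toNNReal _ hK0]
      change dist (t • Φ a + (1 - t) • T a) (t • Φ b + (1 - t) • T b)
        ≤ (1 - t * (1 - ρ)) * dist (a : X) b
      rw [dist_eq_norm, dist_eq_norm]
      have h1 : t • Φ a + (1 - t) • T a - (t • Φ b + (1 - t) • T b) =
        t • (Φ a - Φ b) + (1 - t) • (T a - T b) := by module
      rw [h1]
      refine (norm_add_le _ _).trans ?_
      rw [norm_smul, norm_smul, Real.norm_of_nonneg ht0.le,
        Real.norm_of_nonneg (by linarith : 0 ≤ 1 - t)]
      nlinarith [mul_le_mul_of_nonneg_left (hΦ a a.2 b b.2) ht0.le,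
        mul_le_mul_of_nonneg_left (hT a a.2 b b.2) (by linarith : 0 ≤ 1 - t)]⟩ hx (edist_ne_top _ _)
  exact ⟨z, hz, hfix⟩

/-- This is accretivity of `I - T`: by the path equation `t • (Φ z - z)` is `(1 - t) • (z - T z)`,
and passing from `z` to `y` costs only the residual `T y - y`. -/
theorem dualityMap_viscosity_le (hT : ∀ x ∈ C, ∀ y ∈ C, ‖T x - T y‖ ≤ ‖x - y‖)
    (ht : t ∈ Set.Ioo (0 : ℝ) 1) {z : X} (hz : z ∈ C) (hzt : t • Φ z + (1 - t) • T z = z)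
    {y : X} (hy : y ∈ C) :
    t * dualityMap (y - z) (Φ z - z) ≤ ‖T y - y‖ * ‖y - z‖ := by
  obtain ⟨ht0, ht1⟩ := ht
  have h1 : t • (Φ z - z) = (1 - t) • ((T y - T z) - (T y - y) - (y - z)) := by
    have : t • Φ z = z - (1 - t) • T z := eq_sub_of_add_eq hzt
    rw [smul_sub, this]
    module
  have h2 := congrArg (dualityMap (y - z)) h1
  simp only [map_smul, smul_eq_mul] at h2
  rw [h2, map_sub, map_sub, dualityMap_apply_self]
  have h3 := dualityMap_apply_le (y - z) (T y - T z)
  have h4 := dualityMap_apply_le (y - z) (-(T y - y))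
  rw [map_neg, norm_neg] at h4
  have h5 := mul_le_mul_of_nonneg_left (hT y hy z hz) (norm_nonneg (y - z))
  have h6 : 0 ≤ ‖T y - y‖ * ‖y - z‖ := by positivity
  have h7 : dualityMap (y - z) (T y - T z) - dualityMap (y - z) (T y - y) - ‖y - z‖ ^ 2 ≤
      ‖T y - y‖ * ‖y - z‖ := by nlinarith
  refine (mul_le_mul_of_nonneg_left h7 (by linarith)).trans ?_
  nlinarith

theorem norm_viscosity_sub_le (hT : ∀ x ∈ C, ∀ y ∈ C, ‖T x - T y‖ ≤ ‖x - y‖)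
    (hρ1 : ρ < 1) (hΦ : ∀ x ∈ C, ∀ y ∈ C, ‖Φ x - Φ y‖ ≤ ρ * ‖x - y‖) (ht : t ∈ Set.Ioo (0 : ℝ) 1)
    {z : X} (hz : z ∈ C) (hzt : t • Φ z + (1 - t) • T z = z) {p : X} (hp : p ∈ fixSet C T) :
    ‖z - p‖ ≤ ‖Φ p - p‖ / (1 - ρ) := by
  obtain ⟨ht0, ht1⟩ := ht
  obtain ⟨hpC, hTp⟩ := hp
  have h1 : z - p = t • ((Φ z - Φ p) + (Φ p - p)) + (1 - t) • (T z - T p) := by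
    rw [hTp]
    nth_rw 1 [← hzt]
    module
  have h2 : ‖z - p‖ ≤ t * (ρ * ‖z - p‖ + ‖Φ p - p‖) + (1 - t) * ‖z - p‖ := by
    nth_rw 1 [h1]
    refine (norm_add_le _ _).trans ?_
    rw [norm_smul, norm_smul, Real.norm_of_nonneg ht0.le,
      Real.norm_of_nonneg (by linarith : 0 ≤ 1 - t)]
    have := norm_add_le (Φ z - Φ p) (Φ p - p)
    exact add_le_add (mul_le_mul_of_nonneg_left (by linarith [hΦ z hz p hpC]) ht0.le)
      (mul_le_mul_of_nonneg_left (hT z hz p hpC) (by linarith))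
  rw [le_div_iff₀ (by linarith)]
  have h3 : t * (‖z - p‖ * (1 - ρ)) ≤ t * ‖Φ p - p‖ := by linarith
  exact le_of_mul_le_mul_left h3 ht0

/-- At `y = q` the residual vanishes, so `J(z - q)(Φ z - z) ≥ 0`; the contraction then replaces `Φ z
- z` by `Φ q - q` at the price of `(1 - ρ) ‖z - q‖²`. -/
theorem UniformlySmooth.sq_norm_viscosity_sub_le (hX : UniformlySmooth X)
    (hT : ∀ x ∈ C, ∀ y ∈ C, ‖T x - T y‖ ≤ ‖x - y‖)
    (hΦ : ∀ x ∈ C, ∀ y ∈ C, ‖Φ x - Φ y‖ ≤ ρ * ‖x - y‖) (ht : t ∈ Set.Ioo (0 : ℝ) 1)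
    {z : X} (hz : z ∈ C) (hzt : t • Φ z + (1 - t) • T z = z) {q : X} (hq : q ∈ fixSet C T) :
    (1 - ρ) * ‖z - q‖ ^ 2 ≤ dualityMap (z - q) (Φ q - q) := by
  have h1 := dualityMap_viscosity_le hT ht hz hzt hq.1
  rw [hq.2, sub_self, norm_zero, zero_mul, hX.dualityMap_sub_comm] at h1
  have h2 : 0 ≤ dualityMap (z - q) (Φ z - z) := by
    by_contra! h
    nlinarith [ht.1]
  have h3 := dualityMap_apply_le (z - q) (Φ z - Φ q)
  have h4 := mul_le_mul_of_nonneg_left (hΦ z hz q hq.1) (norm_nonneg (z - q))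
  have h5 := dualityMap_apply_self (z - q)
  rw [map_sub] at h2 h3 h5 ⊢
  nlinarith

end ViscosityPath

/-! ### A recursive inequality for real sequences -/

theorem tendsto_zero_of_le_one_sub_mul_add {s γ δ e : ℕ → ℝ} (hs : ∀ n, 0 ≤ s n)
    (hγ : ∀ n, γ n ∈ Set.Icc (0 : ℝ) 1)
    (hγsum : Tendsto (fun N : ℕ => ∑ n ∈ Finset.range N, γ n) atTop atTop)
    (hδ : ∀ ε > 0, ∀ᶠ n in atTop, δ n ≤ ε) (he0 : ∀ n, 0 ≤ e n) (he : Summable e)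
    (h : ∀ n, s (n + 1) ≤ (1 - γ n) * s n + γ n * δ n + e n) :
    Tendsto s atTop (𝓝 0) := by
  rw [Metric.tendsto_atTop]
  intro ε hε
  obtain ⟨N₁, hN₁⟩ := eventually_atTop.mp (hδ (ε / 4) (by positivity))
  obtain ⟨N₂, hN₂⟩ := eventually_atTop.mp
    ((tendsto_sum_nat_add e).eventually (gt_mem_nhds (show (0 : ℝ) < ε / 4 by positivity)))
  set N := max N₁ N₂
  -- Each step forms a convex combination with `δ n ≤ ε / 4`, so that level persists, while `1 - γ ≤
  -- exp (-γ)` damps the initial value.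
  have hind : ∀ k, s (N + k) ≤ ε / 4 + s N * Real.exp (-∑ i ∈ Finset.range k, γ (N + i)) +
      ∑ i ∈ Finset.range k, e (i + N) := by
    intro k
    induction k with
    | zero => simp; linarith
    | succ k ih =>
      have h1 := h (N + k)
      have h2 := hN₁ (N + k) ((le_max_left _ _).trans (Nat.le_add_right _ _))
      obtain ⟨h3, h4⟩ := hγ (N + k)
      rw [Finset.sum_range_succ, Finset.sum_range_succ, neg_add, Real.exp_add, add_comm k N]
      have h5 : 1 - γ (N + k) ≤ Real.exp (-γ (N + k)) := by
        linarith [Real.add_one_le_exp (-γ (N + k))]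
      have h6 := mul_le_mul_of_nonneg_left h5
        (mul_nonneg (hs N) (Real.exp_nonneg (-∑ i ∈ Finset.range k, γ (N + i))))
      have h7 := mul_le_mul_of_nonneg_left ih (sub_nonneg.mpr h4)
      have h8 := mul_le_mul_of_nonneg_left h2 h3
      have h9 : 0 ≤ ∑ i ∈ Finset.range k, e (i + N) := Finset.sum_nonneg fun i _ => he0 _
      have h10 := mul_nonneg h3 h9
      rw [← add_assoc N k 1]
      linarith
  have htail : ∀ k, ∑ i ∈ Finset.range k, e (i + N) < ε / 4 := fun k =>
    (((summable_nat_add_iff N).mpr he).sum_le_tsum _ fun i _ => he0 _).trans_lt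
      (hN₂ N (le_max_right _ _))
  have hγN : Tendsto (fun k => ∑ i ∈ Finset.range k, γ (N + i)) atTop atTop := by
    have h1 := tendsto_atTop_add_const_left atTop (-∑ i ∈ Finset.range N, γ i)
      (hγsum.comp (tendsto_add_atTop_nat N))
    refine h1.congr fun k => ?_
    simp only [Function.comp_apply]
    rw [add_comm k N, Finset.sum_range_add]
    ring
  have hexp : Tendsto (fun k => s N * Real.exp (-∑ i ∈ Finset.range k, γ (N + i))) atTop (𝓝 0) := by
    simpa using (Real.tendsto_exp_neg_atTop_nhds_zero.comp hγN).const_mul (s N)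
  obtain ⟨k₀, hk₀⟩ := eventually_atTop.mp
    (hexp.eventually (gt_mem_nhds (show (0 : ℝ) < ε / 4 by positivity)))
  refine ⟨N + k₀, fun n hn => ?_⟩
  obtain ⟨k, rfl⟩ := Nat.exists_eq_add_of_le ((Nat.le_add_right N k₀).trans hn)
  rw [Real.dist_eq, sub_zero, abs_of_nonneg (hs _)]
  linarith [hind k, htail k, hk₀ k (by omega)]

/-! ### Accumulation of the path at a fixed point -/

section Limit

variable {X : Type*} [NormedAddCommGroup X] [NormedSpace ℝ X]

/-- If a bounded sequence asymptotically consists of fixed points of a nonexpansive map `T : C → C`,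
then, along any ultrafilter, some fixed point of `T` minimizes over `C` the limiting distance
`φ` to the sequence. -/
theorem UniformlySmooth.exists_fixed_asymptotic_center [CompleteSpace X] (hX : UniformlySmooth X) {C : Set X}
    (hCne : C.Nonempty) (hCcl : IsClosed C) (hCconv : Convex ℝ C) {T : X → X}
    (hTC : Set.MapsTo T C C) (hT : ∀ x ∈ C, ∀ y ∈ C, ‖T x - T y‖ ≤ ‖x - y‖) {ι : Type*}
    (U : Ultrafilter ι) {z : ι → X} (hzC : ∀ i, z i ∈ C)
    (hzT : Tendsto (fun i => ‖z i - T (z i)‖) U (𝓝 0)) {φ : X → ℝ}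
    (hφ : ∀ x, Tendsto (fun i => ‖z i - x‖) U (𝓝 (φ x))) :
    ∃ q ∈ fixSet C T, ∀ x ∈ C, φ q ≤ φ x := by
  have hφT : ∀ x ∈ C, φ (T x) ≤ φ x := fun x hx => by
    have h := hzT.add (hφ x)
    rw [zero_add] at h
    refine le_of_tendsto_of_tendsto' (hφ (T x)) h fun i => ?_
    have := norm_add_le (z i - T (z i)) (T (z i) - T x)
    rw [sub_add_sub_cancel] at this
    linarith [hT _ (hzC i) x hx]
  have hφ0 : ∀ x, 0 ≤ φ x := fun x => ge_of_tendsto' (hφ x) fun i => norm_nonneg _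
  have hφsub : ∀ x y, ‖x - y‖ ≤ φ x + φ y := fun x y =>
    ge_of_tendsto' ((hφ x).add (hφ y)) fun i => by
      have := norm_sub_le (z i - y) (z i - x)
      rw [sub_sub_sub_cancel_left] at this
      linarith
  have hφlip : LipschitzWith 1 φ := LipschitzWith.of_le_add fun x y => by
    refine le_of_tendsto_of_tendsto' (hφ x) ((hφ y).add_const _) fun i => ?_
    have := norm_add_le (z i - y) (y - x)
    rw [sub_add_sub_cancel] at this
    rwa [dist_comm, dist_eq_norm]
  have hφconv : ConvexOn ℝ C φ := ⟨hCconv, fun x _ y _ a b ha hb hab => by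
    refine le_of_tendsto_of_tendsto' (hφ _) (((hφ x).const_smul a).add ((hφ y).const_smul b))
      fun i => ?_
    have h1 : z i - (a • x + b • y) = a • (z i - x) + b • (z i - y) := by
      nth_rw 1 [← one_smul ℝ (z i), ← hab]
      module
    rw [h1]
    refine (norm_add_le _ _).trans ?_
    rw [norm_smul, norm_smul, Real.norm_of_nonneg ha, Real.norm_of_nonneg hb]
    rfl⟩
  have hbdd : BddBelow (φ '' C) := ⟨0, by rintro _ ⟨x, -, rfl⟩; exact hφ0 x⟩
  set m := sInf (φ '' C)
  have hclosed : ∀ r, IsClosed {x ∈ C | φ x ≤ r} := fun r =>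
    hCcl.inter (isClosed_le hφlip.continuous continuous_const)
  obtain ⟨x₁, hx₁⟩ := hCne
  have hnorm : ∀ r, ∀ x ∈ {x ∈ C | φ x ≤ r}, ‖x‖ ≤ r + φ x₁ + ‖x₁‖ := fun r x hx => by
    have h1 := norm_add_le (x - x₁) x₁
    rw [sub_add_cancel] at h1
    linarith [hφsub x x₁, hx.2]
  obtain ⟨x₀, hx₀⟩ := hX.nonempty_iInter_of_directed
    (A := fun n : ℕ => {x ∈ C | φ x ≤ m + 1 / ((n : ℝ) + 1)})
    (by
      refine Antitone.directed_ge fun i j hij x hx => ⟨hx.1, hx.2.trans ?_⟩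
      have := one_div_le_one_div_of_le (by positivity : (0 : ℝ) < i + 1)
        (by exact_mod_cast Nat.add_le_add_right hij 1 : (i : ℝ) + 1 ≤ j + 1)
      linarith)
    (fun n => by
      obtain ⟨_, ⟨x, hx, rfl⟩, hlt⟩ := exists_lt_of_csInf_lt (⟨_, x₁, hx₁, rfl⟩ : (φ '' C).Nonempty)
        (show m < m + 1 / ((n : ℝ) + 1) by linarith [Nat.one_div_pos_of_nat (α := ℝ) (n := n)])
      exact ⟨x, hx, hlt.le⟩)
    (fun n => hclosed _) (fun n => hφconv.convex_le _) (i₀ := 0) (hnorm _)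
  rw [Set.mem_iInter] at hx₀
  have hx₀m : φ x₀ ≤ m := by
    have h := (tendsto_one_div_add_atTop_nhds_zero_nat (𝕜 := ℝ)).const_add m
    rw [add_zero] at h
    exact ge_of_tendsto' h fun n => (hx₀ n).2
  -- The minimizers form a bounded closed convex set, invariant since `φ (T x) ≤ φ x`.
  obtain ⟨q, hq, hTq⟩ := hX.exists_fixed_point (hφconv.convex_le m) (hclosed m)
    ⟨x₀, (hx₀ 0).1, hx₀m⟩ (hnorm m) (T := T) (fun x hx => ⟨hTC hx.1, (hφT x hx.1).trans hx.2⟩)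
    fun x hx y hy => hT x hx.1 y hy.1
  exact ⟨q, ⟨hq.1, hTq⟩, fun x hx => hq.2.trans (csInf_le hbdd ⟨x, hx, rfl⟩)⟩

/-- First-order condition for a minimizer of the limiting distance to a bounded family. -/
theorem UniformlySmooth.eventually_dualityMap_le (hX : UniformlySmooth X) {C : Set X}
    (hCconv : Convex ℝ C) {ι : Type*} {U : Filter ι} [U.NeBot] {z : ι → X} {R : ℝ} {φ : X → ℝ}
    (hφ : ∀ x, Tendsto (fun i => ‖z i - x‖) U (𝓝 (φ x))) {q : X} (hq : q ∈ C)
    (hR : ∀ i, ‖z i - q‖ ≤ R) (hR0 : 0 ≤ R)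
    (hmin : ∀ x ∈ C, φ q ≤ φ x) {p : X} (hp : p ∈ C) {ε : ℝ} (hε : 0 < ε) :
    ∀ᶠ i in U, dualityMap (z i - q) (p - q) ≤ ε := by
  set v := p - q with hv
  set η := ε / (2 * (‖v‖ + 1)) with hη
  have hη0 : 0 < η := by positivity
  obtain ⟨δ, hδ, hJ⟩ := hX.dualityMap_uniformContinuous hR0 hη0
  set τ := min 1 (δ / (‖v‖ + 1)) with hτ
  have hτ0 : 0 < τ := by positivity
  have hτv : τ * ‖v‖ ≤ δ := by
    have h1 : τ ≤ δ / (‖v‖ + 1) := min_le_right _ _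
    rw [le_div_iff₀ (by positivity)] at h1
    nlinarith
  set w := q + τ • v with hw
  have hwC : w ∈ C := by
    have h1 : w = (1 - τ) • q + τ • p := by rw [hw, hv]; module
    rw [h1]
    exact hCconv hq hp (sub_nonneg.mpr (min_le_left _ _)) hτ0.le (by ring)
  have hlim : Tendsto (fun i => ‖z i - w‖ * (‖z i - q‖ - ‖z i - w‖)) U
      (𝓝 (φ w * (φ q - φ w))) := (hφ w).mul ((hφ q).sub (hφ w))
  have hφw : 0 ≤ φ w := ge_of_tendsto' (hφ w) fun i => norm_nonneg _
  have hneg : φ w * (φ q - φ w) < τ * (ε / 2) := by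
    have h1 : φ w * (φ q - φ w) ≤ 0 :=
      mul_nonpos_of_nonneg_of_nonpos hφw (sub_nonpos.mpr (hmin w hwC))
    exact h1.trans_lt (by positivity)
  -- Testing `J(z - w)` on `z - q = (z - w) + τ • v` bounds `τ * J(z - w) v` by `‖z - w‖ * (‖z - q‖
  -- - ‖z - w‖)`, whose limit is nonpositive; uniform continuity then moves `w` back to `q`.
  filter_upwards [hlim.eventually (gt_mem_nhds hneg)] with i hi
  have h1 : z i - q = (z i - w) + τ • v := by rw [hw]; module
  have h2 := dualityMap_apply_le (z i - w) (z i - q)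
  nth_rw 1 [h1] at h2
  rw [map_add, dualityMap_apply_self, map_smul, smul_eq_mul] at h2
  have h3 : dualityMap (z i - w) v ≤ ε / 2 := by
    refine le_of_mul_le_mul_left (?_ : τ * _ ≤ τ * _) hτ0
    nlinarith
  have h4 := (le_abs_self _).trans ((dualityMap (z i - q) - dualityMap (z i - w)).le_of_opNorm_le
    (hJ _ _ (hR i) (by
      rw [sub_sub_sub_cancel_left, hw, add_sub_cancel_left, norm_smul, Real.norm_of_nonneg hτ0.le]
      exact hτv)) v)
  rw [sub_apply] at h4
  have h5 : η * ‖v‖ ≤ ε / 2 := by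
    rw [hη, div_mul_eq_mul_div, div_le_div_iff₀ (by positivity) (by norm_num)]
    nlinarith [norm_nonneg v]
  linarith

variable {C : Set X} {T Φ : X → X} {ρ : ℝ}

/-- The points `z = t Φ z + (1 - t) T z` accumulate at some fixed point of `T`. -/
theorem UniformlySmooth.exists_viscosity_limit [CompleteSpace X] (hX : UniformlySmooth X)
    (hCcl : IsClosed C) (hCconv : Convex ℝ C) (hTC : Set.MapsTo T C C)
    (hT : ∀ x ∈ C, ∀ y ∈ C, ‖T x - T y‖ ≤ ‖x - y‖) (hF : (fixSet C T).Nonempty)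
    (hΦC : Set.MapsTo Φ C C) (hρ0 : 0 ≤ ρ)
    (hρ1 : ρ < 1) (hΦ : ∀ x ∈ C, ∀ y ∈ C, ‖Φ x - Φ y‖ ≤ ρ * ‖x - y‖) :
    ∃ q ∈ fixSet C T, ∀ ε > 0, ∃ t ∈ Set.Ioo (0 : ℝ) 1, ∃ z ∈ C,
      t • Φ z + (1 - t) • T z = z ∧ ‖z - q‖ < ε := by
  obtain ⟨p, hp⟩ := hF
  have hCne : C.Nonempty := ⟨p, hp.1⟩
  -- The shift by 2 keeps `t 0` below 1.
  set t : ℕ → ℝ := fun n => 1 / ((n : ℝ) + 2) with ht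
  have htI : ∀ n, t n ∈ Set.Ioo (0 : ℝ) 1 := fun n =>
    ⟨by positivity, by rw [ht, div_lt_one (by positivity)]; linarith [n.cast_nonneg (α := ℝ)]⟩
  have ht0 : Tendsto t atTop (𝓝 0) := by
    have := (tendsto_add_atTop_iff_nat 1).mpr (tendsto_one_div_add_atTop_nhds_zero_nat (𝕜 := ℝ))
    refine this.congr fun n => ?_
    rw [ht]; push_cast; ring_nf
  choose z hzC hz using fun n =>
    exists_viscosity_point hCne hCcl hCconv hTC hT hΦC hρ0 hρ1 hΦ (htI n)
  have hzb : ∀ p ∈ fixSet C T, ∀ n, ‖z n - p‖ ≤ ‖Φ p - p‖ / (1 - ρ) := fun p hp n =>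
    norm_viscosity_sub_le hT hρ1 hΦ (htI n) (hzC n) (hz n) hp
  set B := ‖Φ p - p‖ / (1 - ρ)
  let U := hyperfilter ℕ
  have hU : (U : Filter ℕ) ≤ atTop := Nat.hyperfilter_le_atTop
  have hzT : Tendsto (fun n => ‖z n - T (z n)‖) U (𝓝 0) := by
    refine Tendsto.mono_left ?_ hU
    have hlim := ht0.mul_const (ρ * B + ‖Φ p - p‖ + B)
    rw [zero_mul] at hlim
    refine squeeze_zero (fun n => norm_nonneg _) (fun n => ?_) hlim
    have h1 : z n - T (z n) = t n • ((Φ (z n) - Φ p) + (Φ p - p) - (T (z n) - T p)) := by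
      rw [hp.2]
      nth_rw 1 [← hz n]
      module
    rw [h1, norm_smul, Real.norm_of_nonneg (htI n).1.le]
    refine mul_le_mul_of_nonneg_left ?_ (htI n).1.le
    have h2 := norm_sub_le ((Φ (z n) - Φ p) + (Φ p - p)) (T (z n) - T p)
    have h3 := norm_add_le (Φ (z n) - Φ p) (Φ p - p)
    have h4 := hΦ _ (hzC n) p hp.1
    have h5 := hT _ (hzC n) p hp.1
    have h6 := hzb p hp n
    have h7 := mul_le_mul_of_nonneg_left h6 hρ0
    linarith
  have hex : ∀ x, ∃ L, Tendsto (fun n => ‖z n - x‖) U (𝓝 L) := fun x => by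
    obtain ⟨L, -, hL⟩ := (isCompact_Icc (a := (0 : ℝ)) (b := B + ‖p - x‖)).ultrafilter_le_nhds
      (U.map fun n => ‖z n - x‖) (by
        rw [le_principal_iff]
        refine Filter.mem_map.mpr (Eventually.of_forall fun n => ⟨norm_nonneg _, ?_⟩)
        have := norm_add_le (z n - p) (p - x)
        rw [sub_add_sub_cancel] at this
        linarith [hzb p hp n])
    exact ⟨L, hL⟩
  choose φ hφ using hex
  obtain ⟨q, hq, hmin⟩ := hX.exists_fixed_asymptotic_center hCne hCcl hCconv hTC hT U hzC hzT hφ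
  refine ⟨q, hq, fun ε hε => ?_⟩
  -- The competitor is `p = Φ q`; the tolerance is chosen to give `‖z n - q‖ ≤ ε / 2`.
  obtain ⟨n, hn⟩ := (hX.eventually_dualityMap_le hCconv hφ hq.1 (hzb q hq)
    (div_nonneg (norm_nonneg _) (by linarith)) hmin
    (hΦC hq.1) (ε := (1 - ρ) * (ε / 2) ^ 2) (by have : 0 < 1 - ρ := by linarith
                                                positivity)).exists
  refine ⟨t n, htI n, z n, hzC n, hz n, ?_⟩
  have h1 := (hX.sq_norm_viscosity_sub_le hT hΦ (htI n) (hzC n) (hz n) hq).trans hn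
  have h2 := le_of_mul_le_mul_left h1 (by linarith)
  have h3 := abs_le_of_sq_le_sq h2 (by positivity)
  linarith [(abs_le.mp h3).2]

end Limit

/-! ### The variational inequality and the explicit iteration -/

section Iteration

variable {X : Type*} [NormedAddCommGroup X] [NormedSpace ℝ X] {C : Set X} {T Φ : X → X} {ρ : ℝ}

/-- If `q` is an accumulation point of the points `z = t Φ z + (1 - t) T z`, then asymptotic fixed
points of `T` asymptotically satisfy the variational inequality at `q`. -/
theorem UniformlySmooth.eventually_dualityMap_sub_le (hX : UniformlySmooth X)
    (hT : ∀ x ∈ C, ∀ y ∈ C, ‖T x - T y‖ ≤ ‖x - y‖) (hρ1 : ρ < 1)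
    (hΦ : ∀ x ∈ C, ∀ y ∈ C, ‖Φ x - Φ y‖ ≤ ρ * ‖x - y‖) {q : X} (hq : q ∈ C)
    (hqz : ∀ ε > 0, ∃ t ∈ Set.Ioo (0 : ℝ) 1, ∃ z ∈ C,
      t • Φ z + (1 - t) • T z = z ∧ ‖z - q‖ < ε)
    {y : ℕ → X} (hyC : ∀ n, y n ∈ C) {R : ℝ} (hR0 : 0 ≤ R) (hR : ∀ n, ‖y n - q‖ ≤ R)
    (hyT : Tendsto (fun n => ‖T (y n) - y n‖) atTop (𝓝 0)) {ε : ℝ} (hε : 0 < ε) :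
    ∀ᶠ n in atTop, dualityMap (y n - q) (Φ q - q) ≤ ε := by
  set v := Φ q - q
  set η := ε / (3 * (‖v‖ + 1)) with hη
  obtain ⟨δ, hδ, hJ⟩ := hX.dualityMap_uniformContinuous hR0 (show 0 < η by positivity)
  -- `z` and `t` are fixed before `n`, so dividing the vanishing residual by `t` is harmless.
  obtain ⟨t, ht, z, hz, hzt, hzq⟩ := hqz (min (min 1 δ) (ε / (6 * (R + 1)))) (by positivity)
  have hz1 : ‖z - q‖ ≤ 1 := hzq.le.trans ((min_le_left _ _).trans (min_le_left _ _))
  have hzδ : ‖z - q‖ ≤ δ := hzq.le.trans ((min_le_left _ _).trans (min_le_right _ _))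
  have hzε : ‖z - q‖ ≤ ε / (6 * (R + 1)) := hzq.le.trans (min_le_right _ _)
  have ht0 := ht.1
  filter_upwards [hyT.eventually (gt_mem_nhds
    (show (0 : ℝ) < t * ε / (3 * (R + 1)) by positivity))] with n hn
  have hyz : ‖y n - z‖ ≤ R + 1 := by
    have := norm_sub_le (y n - q) (z - q)
    rw [sub_sub_sub_cancel_right] at this
    linarith [hR n]
  have h1 : dualityMap (y n - z) (Φ z - z) ≤ ε / 3 := by
    refine le_of_mul_le_mul_left ((dualityMap_viscosity_le hT ht hz hzt (hyC n)).trans ?_) ht0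
    rw [lt_div_iff₀ (by positivity)] at hn
    have := mul_le_mul_of_nonneg_left hyz (norm_nonneg (T (y n) - y n))
    linarith
  have h2 : dualityMap (y n - z) (v - (Φ z - z)) ≤ ε / 3 := by
    refine (dualityMap_apply_le _ _).trans ?_
    have h3 : ‖v - (Φ z - z)‖ ≤ 2 * ‖z - q‖ := by
      have h4 : v - (Φ z - z) = (Φ q - Φ z) + (z - q) := by simp only [v]; abel
      have h5 := hΦ q hq z hz
      rw [norm_sub_rev q z] at h5
      rw [h4]
      refine (norm_add_le _ _).trans ?_
      nlinarith [norm_nonneg (z - q)]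
    have h6 : ‖v - (Φ z - z)‖ ≤ ε / (3 * (R + 1)) := by
      refine h3.trans ((mul_le_mul_of_nonneg_left hzε (by norm_num)).trans (le_of_eq ?_))
      field_simp
      norm_num
    refine (mul_le_mul hyz h6 (norm_nonneg _) (by positivity)).trans (le_of_eq ?_)
    field_simp
  have h7 := (le_abs_self _).trans ((dualityMap (y n - q) - dualityMap (y n - z)).le_of_opNorm_le
    (hJ _ (y n - z) (hR n) (by rwa [sub_sub_sub_cancel_left])) v)
  rw [sub_apply] at h7
  have h8 : η * ‖v‖ ≤ ε / 3 := by
    rw [hη, div_mul_eq_mul_div, div_le_div_iff₀ (by positivity) (by norm_num)]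
    nlinarith [norm_nonneg v]
  rw [map_sub] at h2
  linarith

theorem UniformlySmooth.isVISolution_of_viscosity_limit (hX : UniformlySmooth X)
    (hT : ∀ x ∈ C, ∀ y ∈ C, ‖T x - T y‖ ≤ ‖x - y‖) (hρ1 : ρ < 1)
    (hΦ : ∀ x ∈ C, ∀ y ∈ C, ‖Φ x - Φ y‖ ≤ ρ * ‖x - y‖) {q : X} (hq : q ∈ fixSet C T)
    (hqz : ∀ ε > 0, ∃ t ∈ Set.Ioo (0 : ℝ) 1, ∃ z ∈ C,
      t • Φ z + (1 - t) • T z = z ∧ ‖z - q‖ < ε) : IsVISolution C T Φ q := by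
  refine ⟨hq, fun x hx j hj => ?_⟩
  rw [hX.eq_dualityMap hj]
  refine le_of_forall_pos_le_add fun ε hε => ?_
  rw [zero_add]
  obtain ⟨n, hn⟩ := (hX.eventually_dualityMap_sub_le hT hρ1 hΦ hq.1 hqz (y := fun _ => x)
    (fun _ => hx.1) (norm_nonneg (x - q)) (fun _ => le_rfl) (by simp [hx.2]) hε).exists
  exact hn

/-- Adding the inequalities for the two solutions gives `(1 - ρ) ‖p - q‖² ≤ 0`. -/
theorem UniformlySmooth.isVISolution_unique (hX : UniformlySmooth X) (hρ1 : ρ < 1)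
    (hΦ : ∀ x ∈ C, ∀ y ∈ C, ‖Φ x - Φ y‖ ≤ ρ * ‖x - y‖) {p q : X} (hp : IsVISolution C T Φ p)
    (hq : IsVISolution C T Φ q) : p = q := by
  have h1 := hp.2 q hq.1 _ (dualityMap_mem _)
  have h2 := hq.2 p hp.1 _ (dualityMap_mem _)
  have h3 := dualityMap_apply_le (p - q) (Φ p - Φ q)
  have h4 := dualityMap_apply_self (p - q)
  have h5 := mul_le_mul_of_nonneg_left (hΦ p hp.1.1 q hq.1.1) (norm_nonneg (p - q))
  rw [hX.dualityMap_sub_comm] at h1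
  rw [map_sub] at h1 h2 h3 h4
  have h6 : (1 - ρ) * ‖p - q‖ ^ 2 ≤ 0 := by nlinarith
  have h7 : ‖p - q‖ ^ 2 ≤ 0 := by
    by_contra! h
    nlinarith [mul_pos (show 0 < 1 - ρ by linarith) h]
  exact sub_eq_zero.mp (norm_eq_zero.mp (pow_eq_zero_iff two_ne_zero |>.mp
    (le_antisymm h7 (sq_nonneg _))))

theorem norm_viscosity_step_sub_le {a : ℝ} (ha : a ∈ Set.Ioo (0 : ℝ) 1)
    (hΦ : ∀ x ∈ C, ∀ y ∈ C, ‖Φ x - Φ y‖ ≤ ρ * ‖x - y‖) {x y : X} (hx : x ∈ C) (hy : y ∈ C) :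
    ‖a • (Φ x - Φ y) + (1 - a) • (x - y)‖ ≤ (1 - (1 - ρ) * a) * ‖x - y‖ := by
  refine (norm_add_le _ _).trans ?_
  rw [norm_smul, norm_smul, Real.norm_of_nonneg ha.1.le,
    Real.norm_of_nonneg (by linarith [ha.2] : 0 ≤ 1 - a)]
  nlinarith [mul_le_mul_of_nonneg_left (hΦ x hx y hy) ha.1.le]

variable {α : ℕ → ℝ} {x : ℕ → X}

theorem viscosity_iterate_mem (hCconv : Convex ℝ C) (hTC : Set.MapsTo T C C)
    (hΦC : Set.MapsTo Φ C C) (hα : ∀ n, α n ∈ Set.Ioo (0 : ℝ) 1) (hx0 : x 0 ∈ C)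
    (hx : ∀ n, x (n + 1) = T (α n • Φ (x n) + (1 - α n) • x n)) (n : ℕ) : x n ∈ C := by
  induction n with
  | zero => exact hx0
  | succ n ih =>
    rw [hx]
    exact hTC (hCconv (hΦC ih) ih (hα n).1.le (by linarith [(hα n).2]) (by ring))

theorem norm_viscosity_step_le_of_le {a : ℝ} (ha : a ∈ Set.Ioo (0 : ℝ) 1) (hρ1 : ρ < 1)
    (hρ0 : 0 ≤ ρ) (hΦ : ∀ x ∈ C, ∀ y ∈ C, ‖Φ x - Φ y‖ ≤ ρ * ‖x - y‖) {x q : X} (hx : x ∈ C)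
    (hq : q ∈ C) {B : ℝ} (hB : ‖Φ q - q‖ ≤ (1 - ρ) * B) (hxB : ‖x - q‖ ≤ B) :
    ‖a • Φ x + (1 - a) • x - q‖ ≤ B := by
  have h1 : a • Φ x + (1 - a) • x - q =
      (a • (Φ x - Φ q) + (1 - a) • (x - q)) + a • (Φ q - q) := by module
  have h2 := norm_viscosity_step_sub_le ha hΦ hx hq
  rw [h1]
  refine (norm_add_le _ _).trans ?_
  rw [norm_smul, Real.norm_of_nonneg ha.1.le]
  have h3 : 0 ≤ 1 - (1 - ρ) * a := by nlinarith [ha.1, ha.2]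
  have h4 := mul_le_mul_of_nonneg_left hxB h3
  have h5 := mul_le_mul_of_nonneg_left hB ha.1.le
  linarith

theorem tendsto_sum_range_mul_shift {α : ℕ → ℝ} {c : ℝ} (hc : 0 < c)
    (h : Tendsto (fun N : ℕ => ∑ n ∈ Finset.range N, α n) atTop atTop) :
    Tendsto (fun N : ℕ => ∑ n ∈ Finset.range N, c * α (n + 1)) atTop atTop := by
  have h1 := (tendsto_atTop_add_const_right atTop (-α 0)
    (h.comp (tendsto_add_atTop_nat 1))).const_mul_atTop hc
  refine h1.congr fun N => ?_
  simp only [Function.comp_apply]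
  rw [← Finset.mul_sum, Finset.sum_range_succ']
  ring

theorem tendsto_norm_viscosity_iterate_succ_sub
    (hT : ∀ x ∈ C, ∀ y ∈ C, ‖T x - T y‖ ≤ ‖x - y‖) (hρ0 : 0 ≤ ρ) (hρ1 : ρ < 1)
    (hΦ : ∀ x ∈ C, ∀ y ∈ C, ‖Φ x - Φ y‖ ≤ ρ * ‖x - y‖) (hα : ∀ n, α n ∈ Set.Ioo (0 : ℝ) 1)
    (hH2 : Tendsto (fun N : ℕ => ∑ n ∈ Finset.range N, α n) atTop atTop)
    (hH3 : Summable (fun n : ℕ => |α (n + 1) - α n|) ∨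
      Tendsto (fun n : ℕ => α n / α (n + 1)) atTop (𝓝 1))
    (hxC : ∀ n, x n ∈ C) (hyC : ∀ n, α n • Φ (x n) + (1 - α n) • x n ∈ C)
    (hx : ∀ n, x (n + 1) = T (α n • Φ (x n) + (1 - α n) • x n)) {D : ℝ}
    (hD : ∀ n, ‖Φ (x n) - x n‖ ≤ D) :
    Tendsto (fun n => ‖x (n + 1) - x n‖) atTop (𝓝 0) := by
  have hD0 : 0 ≤ D := (norm_nonneg _).trans (hD 0)
  have hρ : 0 < 1 - ρ := by linarith
  have hstep : ∀ n, ‖x (n + 1 + 1) - x (n + 1)‖ ≤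
      (1 - (1 - ρ) * α (n + 1)) * ‖x (n + 1) - x n‖ + |α (n + 1) - α n| * D := by
    intro n
    have h1 := hT _ (hyC (n + 1)) _ (hyC n)
    rw [← hx, ← hx] at h1
    have h2 : α (n + 1) • Φ (x (n + 1)) + (1 - α (n + 1)) • x (n + 1) -
        (α n • Φ (x n) + (1 - α n) • x n) =
        (α (n + 1) • (Φ (x (n + 1)) - Φ (x n)) + (1 - α (n + 1)) • (x (n + 1) - x n)) +
          (α (n + 1) - α n) • (Φ (x n) - x n) := by module
    rw [h2] at h1
    refine h1.trans ((norm_add_le _ _).trans ?_)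
    rw [norm_smul, Real.norm_eq_abs]
    exact add_le_add (norm_viscosity_step_sub_le (hα _) hΦ (hxC _) (hxC _))
      (mul_le_mul_of_nonneg_left (hD n) (abs_nonneg _))
  have hγ : ∀ n, (1 - ρ) * α (n + 1) ∈ Set.Icc (0 : ℝ) 1 := fun n =>
    ⟨mul_nonneg hρ.le (hα _).1.le, by nlinarith [(hα (n + 1)).1, (hα (n + 1)).2]⟩
  -- The change of `α` is a summable error in the first case; in the second it is `o(α (n + 1))` and
  -- goes into the `γ * δ` term.
  rcases hH3 with hsum | hratio
  · refine tendsto_zero_of_le_one_sub_mul_add (δ := fun _ => 0) (e := fun n => |α (n + 1) - α n| * D)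
      (fun n => norm_nonneg _) hγ (tendsto_sum_range_mul_shift hρ hH2)
      (fun ε hε => Eventually.of_forall fun _ => hε.le) (fun n => by positivity)
      (hsum.mul_right D) fun n => ?_
    rw [mul_zero, add_zero]
    exact hstep n
  · refine tendsto_zero_of_le_one_sub_mul_add
      (δ := fun n => |1 - α n / α (n + 1)| * (D / (1 - ρ))) (e := fun _ => 0)
      (fun n => norm_nonneg _) hγ (tendsto_sum_range_mul_shift hρ hH2)
      (fun ε hε => ?_) (fun n => le_rfl) summable_zero fun n => ?_
    · have h1 := ((hratio.const_sub 1).abs).mul_const (D / (1 - ρ))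
      rw [sub_self, abs_zero, zero_mul] at h1
      exact (h1.eventually (gt_mem_nhds hε)).mono fun _ h => h.le
    · have h0 := (hα (n + 1)).1
      have h1 : |α (n + 1) - α n| = α (n + 1) * |1 - α n / α (n + 1)| := by
        rw [← abs_of_pos h0, ← abs_mul, abs_of_pos h0, mul_sub, mul_div_cancel₀ _ h0.ne', mul_one]
      have h2 := hstep n
      rw [h1] at h2
      refine h2.trans (le_of_eq ?_)
      field_simp
      ring

/-- The iteration `x (n + 1) = T (α n Φ (x n) + (1 - α n) x n)` converges to any fixed point of `T`
at which the points `z = t Φ z + (1 - t) T z` accumulate. -/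
theorem UniformlySmooth.tendsto_viscosity_iterate (hX : UniformlySmooth X) (hCconv : Convex ℝ C)
    (hTC : Set.MapsTo T C C)
    (hT : ∀ x ∈ C, ∀ y ∈ C, ‖T x - T y‖ ≤ ‖x - y‖) (hΦC : Set.MapsTo Φ C C)
    (hρ0 : 0 ≤ ρ) (hρ1 : ρ < 1)
    (hΦ : ∀ x ∈ C, ∀ y ∈ C, ‖Φ x - Φ y‖ ≤ ρ * ‖x - y‖) {q : X} (hq : q ∈ fixSet C T)
    (hqz : ∀ ε > 0, ∃ t ∈ Set.Ioo (0 : ℝ) 1, ∃ z ∈ C,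
      t • Φ z + (1 - t) • T z = z ∧ ‖z - q‖ < ε)
    (hα : ∀ n, α n ∈ Set.Ioo (0 : ℝ) 1) (hH1 : Tendsto α atTop (𝓝 0))
    (hH2 : Tendsto (fun N : ℕ => ∑ n ∈ Finset.range N, α n) atTop atTop)
    (hH3 : Summable (fun n : ℕ => |α (n + 1) - α n|) ∨
      Tendsto (fun n : ℕ => α n / α (n + 1)) atTop (𝓝 1))
    (hx0 : x 0 ∈ C) (hx : ∀ n, x (n + 1) = T (α n • Φ (x n) + (1 - α n) • x n)) :
    Tendsto x atTop (𝓝 q) := by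
  have hρ : 0 < 1 - ρ := by linarith
  have hxC := viscosity_iterate_mem hCconv hTC hΦC hα hx0 hx
  set y : ℕ → X := fun n => α n • Φ (x n) + (1 - α n) • x n with hy
  have hyC : ∀ n, y n ∈ C := fun n =>
    hCconv (hΦC (hxC n)) (hxC n) (hα n).1.le (by linarith [(hα n).2]) (by ring)
  have hxy : ∀ n, x (n + 1) = T (y n) := hx
  have hxq : ∀ n, ‖x (n + 1) - q‖ ≤ ‖y n - q‖ := fun n => by
    have := hT _ (hyC n) q hq.1
    rwa [hq.2, ← hxy] at this
  -- The ball of radius `B` about `q` contains `x 0` and is preserved by averaging with `Φ` on `C`.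
  set B := max ‖x 0 - q‖ (‖Φ q - q‖ / (1 - ρ)) with hB
  have hB0 : 0 ≤ B := (norm_nonneg _).trans (le_max_left _ _)
  have hΦB : ‖Φ q - q‖ ≤ (1 - ρ) * B := by
    rw [mul_comm, ← div_le_iff₀ hρ]
    exact le_max_right _ _
  have hstepB : ∀ n, ‖x n - q‖ ≤ B → ‖y n - q‖ ≤ B := fun n =>
    norm_viscosity_step_le_of_le (hα n) hρ1 hρ0 hΦ (hxC n) hq.1 hΦB
  have hxB : ∀ n, ‖x n - q‖ ≤ B := fun n => by
    induction n with
    | zero => exact le_max_left _ _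
    | succ n ih => exact (hxq n).trans (hstepB n ih)
  have hyB : ∀ n, ‖y n - q‖ ≤ B := fun n => hstepB n (hxB n)
  have hD : ∀ n, ‖Φ (x n) - x n‖ ≤ ρ * B + (1 - ρ) * B + B := fun n => by
    have h1 : Φ (x n) - x n = (Φ (x n) - Φ q) + (Φ q - q) - (x n - q) := by abel
    rw [h1]
    have h2 := norm_sub_le ((Φ (x n) - Φ q) + (Φ q - q)) (x n - q)
    have h3 := norm_add_le (Φ (x n) - Φ q) (Φ q - q)
    linarith [hΦ _ (hxC n) q hq.1, mul_le_mul_of_nonneg_left (hxB n) hρ0, hxB n]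
  set D := ρ * B + (1 - ρ) * B + B
  have hsucc := tendsto_norm_viscosity_iterate_succ_sub hT hρ0 hρ1 hΦ hα hH2 hH3 hxC hyC hx hD
  have hyT : Tendsto (fun n => ‖T (y n) - y n‖) atTop (𝓝 0) := by
    have hlim := hsucc.add (hH1.mul_const D)
    rw [zero_mul, zero_add] at hlim
    refine squeeze_zero (fun n => norm_nonneg _) (fun n => ?_) hlim
    have h1 : T (y n) - y n = (x (n + 1) - x n) - α n • (Φ (x n) - x n) := by
      rw [hxy, hy]; module
    rw [h1]
    refine (norm_sub_le _ _).trans ?_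
    rw [norm_smul, Real.norm_of_nonneg (hα n).1.le]
    exact add_le_add le_rfl (mul_le_mul_of_nonneg_left (hD n) (hα n).1.le)
  -- Pair `y n - q = w + α n • (Φ q - q)` with `J(y n - q)` and use `2ab ≤ a² + b²`; the factor `2 /
  -- (1 - ρ)` puts the error in the form `γ * δ`.
  have hrec : ∀ n, ‖x (n + 1) - q‖ ^ 2 ≤ (1 - (1 - ρ) * α n) * ‖x n - q‖ ^ 2 +
      (1 - ρ) * α n * (2 / (1 - ρ) * dualityMap (y n - q) (Φ q - q)) + 0 := by
    intro n
    set w := α n • (Φ (x n) - Φ q) + (1 - α n) • (x n - q) with hw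
    have h1 : y n - q = w + α n • (Φ q - q) := by rw [hy, hw]; module
    have h2 := dualityMap_apply_self (y n - q)
    nth_rw 2 [h1] at h2
    rw [map_add, map_smul, smul_eq_mul] at h2
    have h3 := dualityMap_apply_le (y n - q) w
    have h4 : ‖w‖ ≤ (1 - (1 - ρ) * α n) * ‖x n - q‖ :=
      norm_viscosity_step_sub_le (hα n) hΦ (hxC n) hq.1
    have h5 : 0 ≤ (1 - ρ) * α n := mul_nonneg hρ.le (hα n).1.le
    have h6 : (1 - ρ) * α n ≤ 1 := by nlinarith [(hα n).1, (hα n).2]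
    have h7 : ‖w‖ ^ 2 ≤ (1 - (1 - ρ) * α n) * ‖x n - q‖ ^ 2 := by
      refine (pow_le_pow_left₀ (norm_nonneg _) h4 2).trans ?_
      rw [mul_pow]
      exact mul_le_mul_of_nonneg_right (by nlinarith) (sq_nonneg _)
    have h8 := pow_le_pow_left₀ (norm_nonneg _) (hxq n) 2
    have h9 : (1 - ρ) * α n * (2 / (1 - ρ) * dualityMap (y n - q) (Φ q - q)) =
        2 * (α n * dualityMap (y n - q) (Φ q - q)) := by field_simp
    rw [h9]
    nlinarith [sq_nonneg (‖y n - q‖ - ‖w‖)]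
  have hsq := tendsto_zero_of_le_one_sub_mul_add (e := fun _ => 0) (fun n => sq_nonneg ‖x n - q‖)
    (fun n => ⟨mul_nonneg hρ.le (hα n).1.le, by nlinarith [(hα n).1, (hα n).2]⟩)
    (by simpa only [← Finset.mul_sum] using hH2.const_mul_atTop hρ)
    (fun ε hε => by
      filter_upwards [hX.eventually_dualityMap_sub_le hT hρ1 hΦ hq.1 hqz hyC hB0 hyB hyT
        (show 0 < ε * (1 - ρ) / 2 by positivity)] with n hn
      rw [div_mul_eq_mul_div, div_le_iff₀ hρ]
      linarith)
    (fun n => le_rfl) summable_zero hrec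
  rw [tendsto_iff_norm_sub_tendsto_zero]
  have := hsq.sqrt
  simpa only [Real.sqrt_sq (norm_nonneg _), Real.sqrt_zero] using this

end Iteration

theorem mainTheorem2 {X : Type*} [NormedAddCommGroup X] [NormedSpace ℝ X] [CompleteSpace X]
    (hX : UniformlySmooth X)
    (C : Set X) (hCne : C.Nonempty) (hCcl : IsClosed C) (hCconv : Convex ℝ C)
    (T : X → X) (hTC : Set.MapsTo T C C) (hT : ∀ x ∈ C, ∀ y ∈ C, ‖T x - T y‖ ≤ ‖x - y‖)
    (hF : (fixSet C T).Nonempty)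
    (Φ : X → X) (hΦC : Set.MapsTo Φ C C) (ρ : ℝ) (hρ0 : 0 ≤ ρ) (hρ1 : ρ < 1)
    (hΦ : ∀ x ∈ C, ∀ y ∈ C, ‖Φ x - Φ y‖ ≤ ρ * ‖x - y‖)
    (α : ℕ → ℝ) (hα : ∀ n, α n ∈ Set.Ioo (0 : ℝ) 1)
    (hH1 : Tendsto α atTop (𝓝 0))
    (hH2 : Tendsto (fun N : ℕ => ∑ n ∈ Finset.range N, α n) atTop atTop)
    (hH3 : Summable (fun n : ℕ => |α (n + 1) - α n|) ∨
      Tendsto (fun n : ℕ => α n / α (n + 1)) atTop (𝓝 1)) :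
    ∃ q : X, IsVISolution C T Φ q ∧ (∀ q' : X, IsVISolution C T Φ q' → q' = q) ∧
      ∀ x : ℕ → X, x 0 ∈ C →
        (∀ n, x (n + 1) = T (α n • Φ (x n) + (1 - α n) • x n)) →
        Tendsto x atTop (𝓝 q) := by
  obtain ⟨q, hq, hqz⟩ :=
    hX.exists_viscosity_limit hCcl hCconv hTC hT hF hΦC hρ0 hρ1 hΦ
  have hVI := hX.isVISolution_of_viscosity_limit hT hρ1 hΦ hq hqz
  exact ⟨q, hVI, fun q' hq' => hX.isVISolution_unique hρ1 hΦ hq' hVI, fun x hx0 hx =>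
    hX.tendsto_viscosity_iterate hCconv hTC hT hΦC hρ0 hρ1 hΦ hq hqz hα hH1 hH2 hH3 hx0 hx⟩
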